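/- Let $\Gamma$ be Euler's gamma function, $\gamma$ the Euler--Mascheroni constant and $G$ the Barnes $G$-function, the entire function $$G(1+z)=(2\pi)^{z/2}\exp\Big(-\frac{z+z^2(1+\gamma)}{2}\Big)\prod_{k=1}^{\infty}\Big(1+\frac zk\Big)^{k}\exp\Big(\frac{z^2}{2k}-z\Big),$$ which satisfies $G(z+1)=\Gamma(z)\,G(z)$ and $G(1)=1$. For every complex number $x$ with $\operatorname{Re}(x)>-\tfrac12$ the following limit exists and $$\lim_{N\to\infty}\prod_{k=1}^{2N}\Big(1+\frac{2x}{k}\Big)^{-k(-1)^k}=\frac{e^{-x}\,\Gamma(x+\frac12)}{\Gamma(\frac12)}\left(\frac{G(x+\frac12)}{G(x+1)\,G(\frac12)}\right)^{2}.$$ Moreover, the following particular cases ($x=\tfrac12$, $x=2$, $x=-\tfrac14$) hold: $$\lim_{N\to\infty}\prod_{k=1}^{2N}\Big(1+\frac1k\Big)^{-k(-1)^k}=\frac{A^6}{e\,\sqrt{\pi}\,2^{1/6}},\qquad \lim_{N\to\infty}\prod_{k=1}^{2N}\Big(1+\frac4k\Big)^{-k(-1)^k}=\frac{3\pi^2}{16\,e^2},$$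 $$\lim_{N\to\infty}\prod_{k=1}^{2N}\Big(1-\frac1{2k}\Big)^{-k(-1)^k}=\frac{A^3\,e^{-\mathbf{G}/\pi}\,\sqrt{\pi}\,2^{1/6}}{\Gamma(\frac14)},$$ where $A$ is the Glaisher--Kinkelin constant, defined by $\log A=\frac1{12}-\zeta'(-1)$ with $\zeta$ the Riemann zeta function, and $\mathbf{G}=\sum_{k=0}^{\infty}\frac{(-1)^k}{(2k+1)^2}$ is Catalan's constant. -/

import Mathlib

open Filter Topology

/-- The Barnes `G`-function, given by its canonical (Weierstrass) product
`G(1+z) = (2π)^{z/2} exp(-(z + z²(1+γ))/2) ∏_{k ≥ 1} (1 + z/k)^k exp(z²/(2k) - z)`,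
where `γ` is the Euler-Mascheroni constant. The product converges absolutely for every complex
`z`; the resulting entire function is Barnes' solution of `G(z+1) = Γ(z) G(z)`, `G(1) = 1`.
Below `w = 1 + z`, and the product index is shifted by one. -/
noncomputable def barnesG (w : ℂ) : ℂ :=
  let z : ℂ := w - 1
  Complex.exp (z / 2 * (Real.log (2 * Real.pi) : ℝ)
      - (z + z ^ 2 * (1 + (Real.eulerMascheroniConstant : ℂ))) / 2) *
    ∏' k : ℕ, ((1 + z / ((k : ℂ) + 1)) ^ (k + 1) *
      Complex.exp (z ^ 2 / (2 * ((k : ℂ) + 1)) - z))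

/-- The normalization `G(1) = 1`. -/
theorem barnesG_one : barnesG 1 = 1 := by
  simp [barnesG]

/-- The Glaisher-Kinkelin constant `A`, defined by `log A = 1/12 - ζ'(-1)`, where `ζ` is the
Riemann zeta function. The number `ζ'(-1)` is real, see `glaisher_spec`. -/
noncomputable def glaisher : ℝ :=
  Real.exp (1 / 12 - (deriv riemannZeta (-1)).re)

/-- The real number `log A` is equal to the complex number `1/12 - ζ'(-1)`. -/
theorem glaisher_spec : ((Real.log glaisher : ℝ) : ℂ) = 1 / 12 - deriv riemannZeta (-1) := by
  have h : (starRingEnd ℂ) (deriv riemannZeta (-1)) = deriv riemannZeta (-1) := by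
    have h1 : HasDerivAt riemannZeta (deriv riemannZeta (-1)) (-1) :=
      (differentiableAt_riemannZeta (by norm_num)).hasDerivAt
    have h2 := h1.conj_conj
    have h3 : (starRingEnd ℂ) ∘ riemannZeta ∘ (starRingEnd ℂ) = riemannZeta := by
      funext s
      simp [riemannZeta_conj]
    rw [h3] at h2
    simpa using h2.deriv.symm
  have hre : ((deriv riemannZeta (-1)).re : ℂ) = deriv riemannZeta (-1) :=
    Complex.conj_eq_iff_re.mp h
  rw [glaisher, Real.log_exp]
  push_cast
  rw [hre]

/-- Catalan's constant `∑_{k ≥ 0} (-1)^k / (2k+1)²`. -/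
noncomputable def catalanConstant : ℝ :=
  ∑' k : ℕ, (-1 : ℝ) ^ k / (2 * (k : ℝ) + 1) ^ 2

/-! For the general formula, pair the factors `k = 2j+1` and `k = 2j+2`. Since `1 + 2x/(2j+1)` is
the quotient of `1 + (x-1/2)/(j+1)` by `1 - (1/2)/(j+1)`, each pair is the square of a ratio of
Barnes factors at `x - 1/2`, `-1/2` and `x`, times `exp (x/(j+1))` and a Gamma-type quotient
(`alternating_factor_eq`). The exponentials produce harmonic numbers. Subtracting `log N` leaves
Euler's constant, and the released power `N ^ x` completes Euler's limit for `Γ(x+1/2)/Γ(1/2)`.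

The particular cases do not use this formula. Summation by parts writes the logarithm of each
partial product in terms of sums `∑ (n+a) log (n+a)`, logarithms of Gamma quotients and boundary
terms. The constant in the asymptotics of the first sums is governed by the derivative of the
Hurwitz zeta function at `-1` (`tendsto_logHyperfactorial`), obtained by continuing an
Euler-Maclaurin expansion from `Re s > 1`. At `a = 1` it is `log A`; the difference between `a =
1/4` and `a = 3/4` gives Catalan's constant through the functional equation. For `x = 2` the linear
weights cancel and Wallis' product suffices. -/

/-! ### Euler-Maclaurin summation for complex powers -/

lemma norm_le_of_hasDerivAt_unitInterval {f f' : ℝ → ℂ} {C : ℝ} (h0 : f 0 = 0)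
    (hf : ∀ t ∈ Set.Icc (0 : ℝ) 1, HasDerivAt f (f' t) t)
    (hC : ∀ t ∈ Set.Icc (0 : ℝ) 1, ‖f' t‖ ≤ C) :
    ∀ t ∈ Set.Icc (0 : ℝ) 1, ‖f t‖ ≤ C := by
  intro t ht
  have h := (convex_Icc (0 : ℝ) 1).norm_image_sub_le_of_norm_hasDerivWithin_le
    (fun u hu => (hf u hu).hasDerivWithinAt) hC (Set.left_mem_Icc.2 zero_le_one) ht
  have hC0 : 0 ≤ C := (norm_nonneg _).trans (hC t ht)
  rw [h0, sub_zero, sub_zero, Real.norm_of_nonneg ht.1] at h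
  exact h.trans (mul_le_of_le_one_right hC0 ht.2)

lemma hasDerivAt_ofReal_add_cpow {x t : ℝ} (h : 0 < x + t) {r r' : ℂ} (hr : r' = r - 1) :
    HasDerivAt (fun u : ℝ => ((x : ℂ) + u) ^ r) (r * ((x : ℂ) + t) ^ r') t := by
  have h1 : HasDerivAt (fun u : ℂ => ((x : ℂ) + u) ^ r) (r * ((x : ℂ) + t) ^ (r - 1) * 1) (t : ℂ) := by
    refine ((hasDerivAt_id (t : ℂ)).const_add (x : ℂ)).cpow_const ?_
    left
    simpa using h
  rw [hr]
  simpa using h1.comp_ofReal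

/-- The Euler-Maclaurin primitive: `φ(x) - φ(x + 1)` approximates `x ^ (-s)`. -/
noncomputable def eulerMaclaurinTerm (s : ℂ) (x : ℝ) : ℂ :=
  (x : ℂ) ^ (1 - s) / (s - 1) + (x : ℂ) ^ (-s) / 2 + s / 12 * (x : ℂ) ^ (-s - 1)

/-- The remainder on `[x, x+t]`, as a function `K` of `t`, vanishes at `0` together with its first
two derivatives. A bound on the third derivative thus passes to `K 1` by three applications of the
mean value inequality on the unit interval. -/
lemma norm_eulerMaclaurin_remainder_le {s : ℂ} (hs : s ≠ 1) (hs4 : -4 ≤ s.re) {x : ℝ} (hx : 0 < x) :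
    ‖(x : ℂ) ^ (-s) - eulerMaclaurinTerm s x + eulerMaclaurinTerm s (x + 1)‖ ≤
      ‖s * (s + 1) * (s + 2) * (s + 3)‖ * x ^ (-s.re - 4) := by
  have hs1 : s - 1 ≠ 0 := sub_ne_zero.2 hs
  set K : ℝ → ℂ := fun t => (((x : ℂ) + t) ^ (1 - s) - (x : ℂ) ^ (1 - s)) / (s - 1)
    + t * ((x : ℂ) ^ (-s) + ((x : ℂ) + t) ^ (-s)) / 2
    + s * t ^ 2 * (((x : ℂ) + t) ^ (-s - 1) - (x : ℂ) ^ (-s - 1)) / 12 with hK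
  set K1 : ℝ → ℂ := fun t => ((x : ℂ) ^ (-s) - ((x : ℂ) + t) ^ (-s)) / 2
    - s * t * ((x : ℂ) + t) ^ (-s - 1) / 3 - s * t * (x : ℂ) ^ (-s - 1) / 6
    - s * (s + 1) * t ^ 2 * ((x : ℂ) + t) ^ (-s - 2) / 12 with hK1
  set K2 : ℝ → ℂ := fun t => s * (((x : ℂ) + t) ^ (-s - 1) - (x : ℂ) ^ (-s - 1)) / 6
    + s * (s + 1) * t * ((x : ℂ) + t) ^ (-s - 2) / 6
    + s * (s + 1) * (s + 2) * t ^ 2 * ((x : ℂ) + t) ^ (-s - 3) / 12 with hK2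
  set K3 : ℝ → ℂ := fun t =>
    -(s * (s + 1) * (s + 2) * (s + 3) * t ^ 2 * ((x : ℂ) + t) ^ (-s - 4) / 12) with hK3
  have ht : ∀ t : ℝ, HasDerivAt (fun u : ℝ => (u : ℂ)) 1 t := fun t => by
    simpa using (hasDerivAt_id (t : ℂ)).comp_ofReal
  have ht2 : ∀ t : ℝ, HasDerivAt (fun u : ℝ => (u : ℂ) ^ 2) (2 * t) t := fun t => by
    simpa using (hasDerivAt_pow 2 (t : ℂ)).comp_ofReal
  have d0 : ∀ t ∈ Set.Icc (0 : ℝ) 1, HasDerivAt K (K1 t) t := by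
    intro t h
    have hp : 0 < x + t := by linarith [h.1]
    have e0 := hasDerivAt_ofReal_add_cpow hp (r := 1 - s) (r' := -s) (by ring)
    have e1 := hasDerivAt_ofReal_add_cpow hp (r := -s) (r' := -s - 1) (by ring)
    have e2 := hasDerivAt_ofReal_add_cpow hp (r := -s - 1) (r' := -s - 2) (by ring)
    have := (((e0.sub_const ((x : ℂ) ^ (1 - s))).div_const (s - 1)).add
      (((ht t).mul (e1.const_add ((x : ℂ) ^ (-s)))).div_const 2)).add
      ((((ht2 t).const_mul s).mul (e2.sub_const ((x : ℂ) ^ (-s - 1)))).div_const 12)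
    refine this.congr_deriv ?_
    simp only [hK1]
    field_simp
    ring
  have d1 : ∀ t ∈ Set.Icc (0 : ℝ) 1, HasDerivAt K1 (K2 t) t := by
    intro t h
    have hp : 0 < x + t := by linarith [h.1]
    have e1 := hasDerivAt_ofReal_add_cpow hp (r := -s) (r' := -s - 1) (by ring)
    have e2 := hasDerivAt_ofReal_add_cpow hp (r := -s - 1) (r' := -s - 2) (by ring)
    have e3 := hasDerivAt_ofReal_add_cpow hp (r := -s - 2) (r' := -s - 3) (by ring)
    have := ((((e1.const_sub ((x : ℂ) ^ (-s))).div_const 2).sub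
      ((((ht t).const_mul s).mul e2).div_const 3)).sub
      ((((ht t).const_mul s).mul_const ((x : ℂ) ^ (-s - 1))).div_const 6)).sub
      ((((ht2 t).const_mul (s * (s + 1))).mul e3).div_const 12)
    refine this.congr_deriv ?_
    simp only [hK2]
    ring
  have d2 : ∀ t ∈ Set.Icc (0 : ℝ) 1, HasDerivAt K2 (K3 t) t := by
    intro t h
    have hp : 0 < x + t := by linarith [h.1]
    have e2 := hasDerivAt_ofReal_add_cpow hp (r := -s - 1) (r' := -s - 2) (by ring)
    have e3 := hasDerivAt_ofReal_add_cpow hp (r := -s - 2) (r' := -s - 3) (by ring)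
    have e4 := hasDerivAt_ofReal_add_cpow hp (r := -s - 3) (r' := -s - 4) (by ring)
    have := ((((e2.sub_const ((x : ℂ) ^ (-s - 1))).const_mul s).div_const 6).add
      ((((ht t).const_mul (s * (s + 1))).mul e3).div_const 6)).add
      ((((ht2 t).const_mul (s * (s + 1) * (s + 2))).mul e4).div_const 12)
    refine this.congr_deriv ?_
    simp only [hK3]
    ring
  have b3 : ∀ t ∈ Set.Icc (0 : ℝ) 1,
      ‖K3 t‖ ≤ ‖s * (s + 1) * (s + 2) * (s + 3)‖ * x ^ (-s.re - 4) := by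
    intro t h
    have hp : 0 < x + t := by linarith [h.1]
    have hn : ‖((x : ℂ) + t) ^ (-s - 4)‖ = (x + t) ^ (-s.re - 4) := by
      rw [← Complex.ofReal_add, Complex.norm_cpow_eq_rpow_re_of_pos hp]
      simp
    have hle : (x + t) ^ (-s.re - 4) ≤ x ^ (-s.re - 4) :=
      Real.rpow_le_rpow_of_nonpos hx (by linarith [h.1]) (by linarith)
    simp only [hK3]
    rw [norm_neg, norm_div, norm_mul, norm_mul, hn, norm_pow, Complex.norm_real,
      Real.norm_of_nonneg h.1]
    have ht1 : t ^ 2 / 12 ≤ 1 := by nlinarith [h.1, h.2]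
    calc _ = (‖s * (s + 1) * (s + 2) * (s + 3)‖ * (x + t) ^ (-s.re - 4)) * (t ^ 2 / 12) := by
            norm_num; ring
      _ ≤ (‖s * (s + 1) * (s + 2) * (s + 3)‖ * (x + t) ^ (-s.re - 4)) * 1 := by gcongr
      _ ≤ _ := by rw [mul_one]; gcongr
  have b2 := norm_le_of_hasDerivAt_unitInterval (by simp [hK2]) d2 b3
  have b1 := norm_le_of_hasDerivAt_unitInterval (by simp [hK1]) d1 b2
  have b0 := norm_le_of_hasDerivAt_unitInterval (by simp [hK]) d0 b1
  have := b0 1 (Set.right_mem_Icc.2 zero_le_one)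
  convert this using 2
  simp only [hK, eulerMaclaurinTerm]
  push_cast
  ring

/-- The derivative of `eulerMaclaurinTerm s x` in `s` at `s = -1`. -/
noncomputable def eulerMaclaurinDeriv (x : ℝ) : ℝ :=
  (x ^ 2 / 2 - x / 2 + 1 / 12) * Real.log x - x ^ 2 / 4 + 1 / 12

lemma hasDerivAt_eulerMaclaurinTerm {x : ℝ} (hx : 0 < x) :
    HasDerivAt (fun s => eulerMaclaurinTerm s x) (eulerMaclaurinDeriv x : ℂ) (-1) := by
  have hx0 : (x : ℂ) ≠ 0 := by exact_mod_cast hx.ne'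
  have hid := hasDerivAt_id (-1 : ℂ)
  have h1 := (hid.const_sub 1).const_cpow (c := (x : ℂ)) (Or.inl hx0)
  have h2 := hid.neg.const_cpow (c := (x : ℂ)) (Or.inl hx0)
  have h3 := (hid.neg.sub_const 1).const_cpow (c := (x : ℂ)) (Or.inl hx0)
  have := ((h1.div (hid.sub_const 1) (by norm_num)).add (h2.div_const 2)).add
    ((hid.div_const 12).mul h3)
  refine this.congr_deriv ?_
  simp only [id, eulerMaclaurinDeriv]
  have e1 : (x : ℂ) ^ ((1 : ℂ) - -1) = (x : ℂ) ^ 2 := by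
    rw [← Complex.cpow_natCast]; norm_num
  have e2 : (x : ℂ) ^ (-(-1 : ℂ)) = x := by simp
  have e3 : (x : ℂ) ^ (-(-1 : ℂ) - 1) = 1 := by simp
  simp only [Pi.neg_apply, id]
  rw [e1, e2, e3]
  push_cast [Complex.ofReal_log hx.le]
  ring

lemma differentiableAt_eulerMaclaurinTerm {x : ℝ} (hx : 0 < x) {s : ℂ} (hs : s ≠ 1) :
    DifferentiableAt ℂ (fun s => eulerMaclaurinTerm s x) s := by
  have hx0 : (x : ℂ) ≠ 0 := by exact_mod_cast hx.ne'
  have hs1 : s - 1 ≠ 0 := sub_ne_zero.2 hs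
  have h1 : DifferentiableAt ℂ (fun s : ℂ => (x : ℂ) ^ (1 - s)) s :=
    DifferentiableAt.const_cpow (by fun_prop) (Or.inl hx0)
  have h2 : DifferentiableAt ℂ (fun s : ℂ => (x : ℂ) ^ (-s)) s :=
    DifferentiableAt.const_cpow (by fun_prop) (Or.inl hx0)
  have h3 : DifferentiableAt ℂ (fun s : ℂ => (x : ℂ) ^ (-s - 1)) s :=
    DifferentiableAt.const_cpow (by fun_prop) (Or.inl hx0)
  have h4 : DifferentiableAt ℂ (fun s : ℂ => s - 1) s := by fun_prop
  have h5 : DifferentiableAt ℂ (fun s : ℂ => s / 12) s := by fun_prop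
  exact ((h1.div h4 hs1).add (h2.div_const 2)).add (h5.mul h3)

lemma tendsto_eulerMaclaurinTerm_atTop {s : ℂ} (hs : 1 < s.re) :
    Tendsto (eulerMaclaurinTerm s) atTop (𝓝 0) := by
  have key : ∀ r : ℂ, r.re < 0 → Tendsto (fun x : ℝ => (x : ℂ) ^ r) atTop (𝓝 0) := by
    intro r hr
    rw [tendsto_zero_iff_norm_tendsto_zero]
    refine (tendsto_rpow_neg_atTop (y := -r.re) (by linarith)).congr' ?_
    filter_upwards [eventually_gt_atTop 0] with x hx
    rw [Complex.norm_cpow_eq_rpow_re_of_pos hx, neg_neg]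
  have h1 := key (1 - s) (by simp; linarith)
  have h2 := key (-s) (by simp; linarith)
  have h3 := key (-s - 1) (by simp; linarith)
  have h := ((h1.div_const (s - 1)).add (h2.div_const 2)).add (h3.const_mul (s / 12))
  simp only [zero_div, mul_zero, add_zero] at h
  exact h

/-! ### Continuation of the Hurwitz zeta function to a neighbourhood of `-1` -/

/-- A convex region that joins `-1` to the half plane of convergence and avoids the pole. -/
def continuationRegion : Set ℂ := {s | ‖s‖ < 4} ∩ {s | -2 < s.re} ∩ {s | s.re - 1 < s.im}

lemma isOpen_continuationRegion : IsOpen continuationRegion :=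
  ((isOpen_lt continuous_norm continuous_const).inter
    (isOpen_lt continuous_const Complex.continuous_re)).inter
    (isOpen_lt (Complex.continuous_re.sub continuous_const) Complex.continuous_im)

lemma convex_continuationRegion : Convex ℝ continuationRegion := by
  refine Convex.inter (Convex.inter ?_ ?_) ?_
  · have : {s : ℂ | ‖s‖ < 4} = Metric.ball 0 4 := by ext; simp
    rw [this]; exact convex_ball _ _
  · exact convex_halfSpace_re_gt _
  · intro z hz w hw p q hp hq hpq
    simp only [Set.mem_ofPred_eq] at *
    simp
    rcases hp.eq_or_lt with rfl | hp
    · have : q = 1 := by linarith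
      subst this; simpa using hw
    · nlinarith [mul_lt_mul_of_pos_left hz hp, mul_le_mul_of_nonneg_left hw.le hq]

lemma neg_one_mem_continuationRegion : (-1 : ℂ) ∈ continuationRegion := by
  simp [continuationRegion]

lemma ne_one_of_mem_continuationRegion {s : ℂ} (hs : s ∈ continuationRegion) : s ≠ 1 := by
  rintro rfl
  have := hs.2
  simp at this

noncomputable def hurwitzRemainder (a : ℝ) (n : ℕ) (s : ℂ) : ℂ :=
  ((n + a : ℝ) : ℂ) ^ (-s) - eulerMaclaurinTerm s (n + a) + eulerMaclaurinTerm s (n + a + 1)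

lemma sum_hurwitzRemainder (a : ℝ) (N : ℕ) (s : ℂ) :
    ∑ n ∈ Finset.range N, hurwitzRemainder a n s =
      ∑ n ∈ Finset.range N, ((n + a : ℝ) : ℂ) ^ (-s) - eulerMaclaurinTerm s a
        + eulerMaclaurinTerm s (N + a) := by
  induction N with
  | zero => simp
  | succ N ih =>
    rw [Finset.sum_range_succ, Finset.sum_range_succ, ih, hurwitzRemainder]
    have : ((N + 1 : ℕ) : ℝ) + a = N + a + 1 := by push_cast; ring
    rw [this]; ring

lemma norm_hurwitzRemainder_le {a : ℝ} (ha : 0 < a) (ha1 : a ≤ 1) (n : ℕ) {s : ℂ}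
    (hs : s ∈ continuationRegion) :
    ‖hurwitzRemainder a n s‖ ≤ 840 * a ^ (-6 : ℝ) * (1 / |(n : ℝ) + a| ^ (2 : ℝ)) := by
  have hx : 0 < (n : ℝ) + a := by positivity
  have hs4 : ‖s‖ < 4 := hs.1.1
  have hre : -2 < s.re := hs.1.2
  have hre4 : s.re ≤ 4 := (Complex.re_le_norm s).trans hs4.le
  have h := norm_eulerMaclaurin_remainder_le (ne_one_of_mem_continuationRegion hs)
    (by linarith) hx
  refine h.trans ?_
  -- Since `‖s‖ < 4` on the region, the product is at most `4 * 5 * 6 * 7`.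
  have hp : ‖s * (s + 1) * (s + 2) * (s + 3)‖ ≤ 840 := by
    have h1 : ‖s + 1‖ ≤ 5 := (norm_add_le _ _).trans (by norm_num; linarith)
    have h2 : ‖s + 2‖ ≤ 6 := (norm_add_le _ _).trans (by norm_num; linarith)
    have h3 : ‖s + 3‖ ≤ 7 := (norm_add_le _ _).trans (by norm_num; linarith)
    rw [norm_mul, norm_mul, norm_mul]
    calc _ ≤ (4 : ℝ) * 5 * 6 * 7 := by gcongr
      _ = 840 := by norm_num
  -- Split off the exponent `-2` for summability. The rest, `-(s.re + 2)`, lies between `-6` and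
  -- `0`, so its power is largest at `n = 0`, and `a ≤ 1` allows the exponent `-6`.
  have hq : ((n : ℝ) + a) ^ (-s.re - 4) ≤ a ^ (-6 : ℝ) * (1 / |(n : ℝ) + a| ^ (2 : ℝ)) := by
    rw [abs_of_pos hx, one_div, ← Real.rpow_neg hx.le,
      show -s.re - 4 = -(s.re + 2) + -2 by ring, Real.rpow_add hx]
    gcongr
    calc ((n : ℝ) + a) ^ (-(s.re + 2)) ≤ a ^ (-(s.re + 2)) :=
          Real.rpow_le_rpow_of_nonpos ha (by simp) (by linarith)
      _ ≤ a ^ (-6 : ℝ) := Real.rpow_le_rpow_of_exponent_ge ha ha1 (by linarith)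
  rw [mul_assoc 840]
  exact mul_le_mul hp hq (Real.rpow_nonneg hx.le _) (by norm_num)

lemma summable_hurwitzRemainder_bound (a : ℝ) :
    Summable (fun n : ℕ => 840 * a ^ (-6 : ℝ) * (1 / |(n : ℝ) + a| ^ (2 : ℝ))) :=
  ((Real.summable_one_div_nat_add_rpow a 2).2 (by norm_num)).mul_left _

lemma differentiableOn_hurwitzRemainder {a : ℝ} (ha : 0 < a) (n : ℕ) :
    DifferentiableOn ℂ (hurwitzRemainder a n) continuationRegion := by
  intro s hs
  have hx : 0 < (n : ℝ) + a := by positivity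
  have hx0 : ((n + a : ℝ) : ℂ) ≠ 0 := by exact_mod_cast hx.ne'
  have hs1 := ne_one_of_mem_continuationRegion hs
  have h1 : DifferentiableAt ℂ (fun s : ℂ => ((n + a : ℝ) : ℂ) ^ (-s)) s :=
    DifferentiableAt.const_cpow (by fun_prop) (Or.inl hx0)
  exact ((h1.sub (differentiableAt_eulerMaclaurinTerm hx hs1)).add
    (differentiableAt_eulerMaclaurinTerm (by linarith) hs1)).differentiableWithinAt

lemma tendsto_natCast_add_atTop (a : ℝ) : Tendsto (fun N : ℕ => (N : ℝ) + a) atTop atTop :=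
  tendsto_atTop_add_const_right _ _ tendsto_natCast_atTop_atTop

open HurwitzZeta in
lemma hurwitzZeta_eq_add_tsum_of_one_lt_re {a : ℝ} (ha : 0 < a) (ha1 : a ≤ 1) {s : ℂ}
    (hs : s ∈ continuationRegion) (h1 : 1 < s.re) :
    hurwitzZeta (a : UnitAddCircle) s =
      eulerMaclaurinTerm s a + ∑' n, hurwitzRemainder a n s := by
  have hsum : Summable (fun n => hurwitzRemainder a n s) :=
    Summable.of_norm_bounded (summable_hurwitzRemainder_bound a)
      (fun n => norm_hurwitzRemainder_le ha ha1 n hs)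
  have l1 := hsum.hasSum.tendsto_sum_nat
  have l2 := (hasSum_hurwitzZeta_of_one_lt_re ⟨ha.le, ha1⟩ h1).tendsto_sum_nat
  have l3 := (tendsto_eulerMaclaurinTerm_atTop h1).comp (tendsto_natCast_add_atTop a)
  have l4 := (l2.sub_const (eulerMaclaurinTerm s a)).add l3
  have : ∑' n, hurwitzRemainder a n s
      = hurwitzZeta (a : UnitAddCircle) s - eulerMaclaurinTerm s a + 0 := by
    refine tendsto_nhds_unique l1 (l4.congr fun N => ?_)
    rw [sum_hurwitzRemainder]
    simp [Complex.cpow_neg]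
  rw [this]; ring

-- Both sides are analytic on the convex region, the series by locally uniform convergence, and they
-- agree where `1 < s.re`; the identity theorem does the rest.
open HurwitzZeta in
lemma hurwitzZeta_eqOn_add_tsum {a : ℝ} (ha : 0 < a) (ha1 : a ≤ 1) :
    Set.EqOn (hurwitzZeta (a : UnitAddCircle))
      (fun s => eulerMaclaurinTerm s a + ∑' n, hurwitzRemainder a n s) continuationRegion := by
  have hd1 : DifferentiableOn ℂ (hurwitzZeta (a : UnitAddCircle)) continuationRegion :=
    fun s hs => (differentiableAt_hurwitzZeta _
      (ne_one_of_mem_continuationRegion hs)).differentiableWithinAt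
  have hd2 : DifferentiableOn ℂ
      (fun s => eulerMaclaurinTerm s a + ∑' n, hurwitzRemainder a n s) continuationRegion := by
    refine DifferentiableOn.add (fun s hs => (differentiableAt_eulerMaclaurinTerm ha
      (ne_one_of_mem_continuationRegion hs)).differentiableWithinAt) ?_
    exact Complex.differentiableOn_tsum_of_summable_norm (summable_hurwitzRemainder_bound a)
      (differentiableOn_hurwitzRemainder ha) isOpen_continuationRegion
      (fun n s hs => norm_hurwitzRemainder_le ha ha1 n hs)
  -- The point `2 + 2i` lies both in the region and in the half plane of convergence.
  have hmem : (⟨2, 2⟩ : ℂ) ∈ continuationRegion := by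
    refine ⟨⟨?_, ?_⟩, ?_⟩
    · change ‖(⟨2, 2⟩ : ℂ)‖ < 4
      rw [Complex.norm_def, Complex.normSq_mk, Real.sqrt_lt' (by norm_num)]
      norm_num
    · change (-2 : ℝ) < 2; norm_num
    · change (2 : ℝ) - 1 < 2; norm_num
  refine (hd1.analyticOnNhd isOpen_continuationRegion).eqOn_of_preconnected_of_eventuallyEq
    (hd2.analyticOnNhd isOpen_continuationRegion) convex_continuationRegion.isPreconnected hmem ?_
  filter_upwards [isOpen_continuationRegion.mem_nhds hmem,
    (isOpen_lt continuous_const Complex.continuous_re).mem_nhds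
      (show (1 : ℝ) < (⟨2, 2⟩ : ℂ).re by norm_num)] with s hs h1
  exact hurwitzZeta_eq_add_tsum_of_one_lt_re ha ha1 hs h1

open HurwitzZeta in
/-- The derivative at `-1` of the Hurwitz zeta function as a regularized sum. -/
lemma tendsto_deriv_hurwitzZeta_neg_one {a : ℝ} (ha : 0 < a) (ha1 : a ≤ 1) :
    Tendsto (fun N : ℕ => eulerMaclaurinDeriv (N + a)
        - ∑ n ∈ Finset.range N, ((n : ℝ) + a) * Real.log (n + a))
      atTop (𝓝 (deriv (hurwitzZeta (a : UnitAddCircle)) (-1)).re) := by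
  have hm := neg_one_mem_continuationRegion
  have hS := Complex.hasSum_deriv_of_summable_norm (summable_hurwitzRemainder_bound a)
    (differentiableOn_hurwitzRemainder ha) isOpen_continuationRegion
    (fun n s hs => norm_hurwitzRemainder_le ha ha1 n hs) hm
  have hTd : DifferentiableAt ℂ (fun s => ∑' n, hurwitzRemainder a n s) (-1) :=
    (Complex.differentiableOn_tsum_of_summable_norm (summable_hurwitzRemainder_bound a)
      (differentiableOn_hurwitzRemainder ha) isOpen_continuationRegion
      (fun n s hs => norm_hurwitzRemainder_le ha ha1 n hs)).differentiableAt
      (isOpen_continuationRegion.mem_nhds hm)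
  have hder : deriv (hurwitzZeta (a : UnitAddCircle)) (-1) =
      eulerMaclaurinDeriv a + deriv (fun s => ∑' n, hurwitzRemainder a n s) (-1) := by
    rw [((hurwitzZeta_eqOn_add_tsum ha ha1).eventuallyEq_of_mem
      (isOpen_continuationRegion.mem_nhds hm)).deriv_eq]
    exact ((hasDerivAt_eulerMaclaurinTerm ha).add hTd.hasDerivAt).deriv
  have hpow : ∀ n : ℕ, HasDerivAt (fun s : ℂ => ((n + a : ℝ) : ℂ) ^ (-s))
      (-((((n : ℝ) + a) * Real.log (n + a) : ℝ) : ℂ)) (-1) := by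
    intro n
    have hx : 0 < (n : ℝ) + a := by positivity
    have hx0 : ((n + a : ℝ) : ℂ) ≠ 0 := by exact_mod_cast hx.ne'
    have := (hasDerivAt_id (-1 : ℂ)).neg.const_cpow (c := ((n + a : ℝ) : ℂ)) (Or.inl hx0)
    refine this.congr_deriv ?_
    rw [Complex.ofReal_mul, Complex.ofReal_log hx.le]
    simp
  -- Differentiating the telescoped partial sum leaves only two boundary terms; the one at `a`
  -- cancels against the same term in `hder`.
  have hsum : ∀ N : ℕ, ∑ n ∈ Finset.range N, deriv (hurwitzRemainder a n) (-1) =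
      ((eulerMaclaurinDeriv (N + a)
        - ∑ n ∈ Finset.range N, ((n : ℝ) + a) * Real.log (n + a) - eulerMaclaurinDeriv a : ℝ) : ℂ) := by
    intro N
    have h1 : ∑ n ∈ Finset.range N, deriv (hurwitzRemainder a n) (-1) =
        deriv (fun s => ∑ n ∈ Finset.range N, hurwitzRemainder a n s) (-1) := by
      rw [deriv_fun_sum]
      exact fun n _ => (differentiableOn_hurwitzRemainder ha n).differentiableAt
        (isOpen_continuationRegion.mem_nhds hm)
    rw [h1]
    simp only [sum_hurwitzRemainder]
    have h2 := ((HasDerivAt.fun_sum (u := Finset.range N) fun n _ => hpow n).sub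
      (hasDerivAt_eulerMaclaurinTerm ha)).add
      (hasDerivAt_eulerMaclaurinTerm (x := N + a) (by positivity))
    refine h2.deriv.trans ?_
    push_cast
    rw [Finset.sum_neg_distrib]
    ring
  have hT := hS.tendsto_sum_nat
  simp only [hsum] at hT
  have hT' := ((Complex.continuous_re.tendsto _).comp hT).add_const (eulerMaclaurinDeriv a)
  have : (deriv (hurwitzZeta (a : UnitAddCircle)) (-1)).re =
    (deriv (fun s => ∑' n, hurwitzRemainder a n s) (-1)).re + eulerMaclaurinDeriv a := by
    rw [hder]; simp [add_comm]
  rw [this]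
  refine hT'.congr fun N => ?_
  simp

/-! ### Asymptotics of shifted hyperfactorials -/

lemma tendsto_log_add_sub_log (a : ℝ) :
    Tendsto (fun N : ℕ => Real.log (N + a) - Real.log N) atTop (𝓝 0) := by
  have h := (Real.tendsto_mul_log_one_add_of_tendsto (g := fun x => a / x) (t := a) ?_).comp
    tendsto_natCast_atTop_atTop
  · have h2 := h.mul (tendsto_inv_atTop_zero.comp (tendsto_natCast_atTop_atTop (R := ℝ)))
    rw [mul_zero] at h2
    refine h2.congr' ?_
    filter_upwards [eventually_gt_atTop 0,
      (tendsto_natCast_add_atTop a).eventually_gt_atTop 0] with N hN hNa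
    have hN' : (0 : ℝ) < N := by exact_mod_cast hN
    simp only [Function.comp]
    rw [← Real.log_div hNa.ne' hN'.ne', add_div, div_self hN'.ne']
    field_simp
  · refine tendsto_const_nhds.congr' ?_
    filter_upwards [eventually_ne_atTop 0] with x hx
    field_simp

lemma tendsto_mul_log_add_sub_log (a : ℝ) :
    Tendsto (fun N : ℕ => N * (Real.log (N + a) - Real.log N)) atTop (𝓝 a) := by
  have h := (Real.tendsto_mul_log_one_add_of_tendsto (g := fun x => a / x) (t := a) ?_).comp
    tendsto_natCast_atTop_atTop
  · refine h.congr' ?_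
    filter_upwards [eventually_gt_atTop 0,
      (tendsto_natCast_add_atTop a).eventually_gt_atTop 0] with N hN hNa
    have hN' : (0 : ℝ) < N := by exact_mod_cast hN
    simp only [Function.comp]
    rw [← Real.log_div hNa.ne' hN'.ne', add_div, div_self hN'.ne']
  · refine tendsto_const_nhds.congr' ?_
    filter_upwards [eventually_ne_atTop 0] with x hx
    field_simp

lemma tendsto_sq_mul_log_add_sub {a : ℝ} (ha : 0 < a) :
    Tendsto (fun N : ℕ => (N : ℝ) ^ 2 *
      (Real.log (N + a) - Real.log N - a / N + a ^ 2 / (2 * N ^ 2))) atTop (𝓝 0) := by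
  have hlim : Tendsto (fun N : ℕ => 2 * a ^ 3 * (N : ℝ)⁻¹) atTop (𝓝 0) := by
    simpa using (tendsto_inv_atTop_zero.comp
      (tendsto_natCast_atTop_atTop (R := ℝ))).const_mul (2 * a ^ 3)
  refine squeeze_zero_norm' ?_ hlim
  filter_upwards [eventually_gt_atTop 0,
    tendsto_natCast_atTop_atTop.eventually_ge_atTop (2 * a)] with N hN hNa
  have hN' : (0 : ℝ) < N := by exact_mod_cast hN
  have hx : a / N ≤ 1 / 2 := by rw [div_le_iff₀ hN']; linarith
  have hx0 : 0 < a / N := by positivity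
  have habs : |-(a / N)| = a / N := by rw [abs_neg, abs_of_pos hx0]
  have h := Real.abs_log_sub_add_sum_range_le (x := -(a / N)) (by rw [habs]; linarith) 2
  rw [habs] at h
  have hlog : Real.log (N + a) - Real.log N = Real.log (1 - -(a / N)) := by
    rw [← Real.log_div (by positivity) hN'.ne', add_div, div_self hN'.ne', sub_neg_eq_add]
  have he : Real.log (N + a) - Real.log N - a / N + a ^ 2 / (2 * N ^ 2) =
      (∑ i ∈ Finset.range 2, (-(a / (N : ℝ))) ^ (i + 1) / (i + 1)) + Real.log (1 - -(a / N)) := by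
    rw [hlog]; simp [Finset.sum_range_succ]; field_simp; ring
  rw [he, norm_mul, Real.norm_eq_abs, Real.norm_eq_abs, abs_of_nonneg (sq_nonneg (N : ℝ))]
  calc _ ≤ (N : ℝ) ^ 2 * ((a / N) ^ 3 / (1 - a / N)) := by gcongr
    -- The choice `N ≥ 2a` gives `1 - a/N ≥ 1/2`, whence the factor `2` in `hlim`.
    _ ≤ (N : ℝ) ^ 2 * ((a / N) ^ 3 / (1 / 2)) := by
      gcongr; linarith
    _ = _ := by field_simp

lemma tendsto_eulerMaclaurinDeriv_sub {a : ℝ} (ha : 0 < a) :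
    Tendsto (fun N : ℕ => eulerMaclaurinDeriv (N + a) -
      (((N : ℝ) ^ 2 / 2 + (a - 1 / 2) * N + (a ^ 2 / 2 - a / 2 + 1 / 12)) * Real.log N
        - (N : ℝ) ^ 2 / 4)) atTop (𝓝 (1 / 12 + (a ^ 2 - a) / 2)) := by
  have ht : Tendsto (fun N : ℕ => (N : ℝ)⁻¹) atTop (𝓝 0) :=
    tendsto_inv_atTop_zero.comp (tendsto_natCast_atTop_atTop (R := ℝ))
  set c := a ^ 2 / 2 - a / 2 + 1 / 12 with hc
  -- The coefficient of `log (N+a)` is `N^2/2 + (a-1/2)N + c`. Divided by `N^2`, it multiplies the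
  -- second-order Taylor error of `log (N+a) - log N`; the Taylor terms contribute the constant and
  -- the powers of `1/N`.
  have h := ((((ht.const_mul (a - 1 / 2)).const_add (1 / 2)).add ((ht.pow 2).const_mul c)).mul
    (tendsto_sq_mul_log_add_sub ha)).add
    (((ht.const_mul (a * c - a ^ 2 * (a - 1 / 2) / 2)).add
      ((ht.pow 2).const_mul (-a ^ 2 * c / 2))).const_add (1 / 12 + (a ^ 2 - a) / 2))
  simp only [mul_zero, add_zero, zero_add, ne_eq, OfNat.ofNat_ne_zero, not_false_eq_true,
    zero_pow] at h
  refine h.congr' ?_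
  filter_upwards [eventually_gt_atTop 0] with N hN
  have hN' : (N : ℝ) ≠ 0 := by exact_mod_cast hN.ne'
  simp only [eulerMaclaurinDeriv, hc]
  field_simp
  ring

/-- The logarithm of the shifted hyperfactorial. -/
noncomputable def logHyperfactorial (a : ℝ) (N : ℕ) : ℝ :=
  ∑ n ∈ Finset.range N, ((n : ℝ) + a) * Real.log (n + a)

open HurwitzZeta in
lemma tendsto_logHyperfactorial {a : ℝ} (ha : 0 < a) (ha1 : a ≤ 1) :
    Tendsto (fun N : ℕ => logHyperfactorial a N -
      (((N : ℝ) ^ 2 / 2 + (a - 1 / 2) * N + (a ^ 2 / 2 - a / 2 + 1 / 12)) * Real.log N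
        - (N : ℝ) ^ 2 / 4)) atTop
      (𝓝 (1 / 12 + (a ^ 2 - a) / 2 - (deriv (hurwitzZeta (a : UnitAddCircle)) (-1)).re)) := by
  refine ((tendsto_eulerMaclaurinDeriv_sub ha).sub
    (tendsto_deriv_hurwitzZeta_neg_one ha ha1)).congr fun N => ?_
  rw [logHyperfactorial]
  ring

lemma log_glaisher : Real.log glaisher = 1 / 12 - (deriv riemannZeta (-1)).re := by
  rw [glaisher, Real.log_exp]

lemma glaisher_pos : 0 < glaisher := Real.exp_pos _

lemma tendsto_logHyperfactorial_one :
    Tendsto (fun N : ℕ => logHyperfactorial 1 N -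
      (((N : ℝ) ^ 2 / 2 + N / 2 + 1 / 12) * Real.log N - (N : ℝ) ^ 2 / 4)) atTop
      (𝓝 (Real.log glaisher)) := by
  have h := tendsto_logHyperfactorial one_pos le_rfl
  have h1 : ((1 : ℝ) : UnitAddCircle) = 0 := AddCircle.coe_period 1
  rw [h1, HurwitzZeta.hurwitzZeta_zero] at h
  rw [log_glaisher]
  convert h using 2
  · ring
  · ring

/-! ### Gamma quotients and Catalan's constant -/

/-- The logarithm of Euler's limit for `Γ`, taken at `b` and `a`: the factorials cancel in the
difference. -/
lemma tendsto_sum_log_sub_log {a b : ℝ} (ha : 0 < a) (hb : 0 < b) :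
    Tendsto (fun N : ℕ => ∑ i ∈ Finset.range N, (Real.log (i + a) - Real.log (i + b))
      - (a - b) * Real.log N) atTop (𝓝 (Real.log (Real.Gamma b) - Real.log (Real.Gamma a))) := by
  have key : ∀ c : ℝ, 0 < c → Tendsto (fun N => Real.log (Real.GammaSeq c N)) atTop
      (𝓝 (Real.log (Real.Gamma c))) := fun c hc =>
    (Real.GammaSeq_tendsto_Gamma c).log (Real.Gamma_pos_of_pos hc).ne'
  have hlog : ∀ c : ℝ, 0 < c → ∀ N : ℕ, 0 < N → Real.log (Real.GammaSeq c N) =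
      c * Real.log N + Real.log (N.factorial) - ∑ i ∈ Finset.range N, Real.log (i + c)
        - Real.log (N + c) := by
    intro c hc N hN
    have hN' : (0 : ℝ) < N := by exact_mod_cast hN
    have hpos : ∀ j ∈ Finset.range (N + 1), c + (j : ℝ) ≠ 0 := fun j _ => by positivity
    rw [Real.GammaSeq, Real.log_div (by positivity) (Finset.prod_ne_zero_iff.2 hpos),
      Real.log_mul (by positivity) (by positivity), Real.log_rpow hN', Real.log_prod hpos,
      Finset.sum_range_succ]
    simp only [add_comm c]
    ring
  have h := (((key b hb).sub (key a ha)).sub (tendsto_log_add_sub_log a)).add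
    (tendsto_log_add_sub_log b)
  rw [sub_zero, add_zero] at h
  refine h.congr' ?_
  filter_upwards [eventually_gt_atTop 0] with N hN
  rw [hlog a ha N hN, hlog b hb N hN, Finset.sum_sub_distrib]
  ring

lemma hasSum_sin_div_sq : HasSum (fun n : ℕ => Real.sin (2 * Real.pi * (1 / 4) * n) / (n : ℝ) ^ 2)
    catalanConstant := by
  have hinj : Function.Injective (fun k : ℕ => 2 * k + 1) := fun a b h => by simpa using h
  have h0 : ∀ n ∉ Set.range (fun k : ℕ => 2 * k + 1),
      Real.sin (2 * Real.pi * (1 / 4) * n) / (n : ℝ) ^ 2 = 0 := by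
    intro n hn
    rcases Nat.even_or_odd n with h | ⟨m, hm⟩
    · obtain ⟨m, rfl⟩ := h.two_dvd
      have : 2 * Real.pi * (1 / 4) * ((2 * m : ℕ) : ℝ) = m * Real.pi := by push_cast; ring
      rw [this, Real.sin_nat_mul_pi, zero_div]
    · exact absurd ⟨m, hm.symm⟩ hn
  rw [← hinj.hasSum_iff h0]
  have hterm : (fun n : ℕ => Real.sin (2 * Real.pi * (1 / 4) * n) / (n : ℝ) ^ 2) ∘
      (fun k : ℕ => 2 * k + 1) = fun k : ℕ => (-1 : ℝ) ^ k / (2 * (k : ℝ) + 1) ^ 2 := by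
    funext k
    have : 2 * Real.pi * (1 / 4) * ((2 * k + 1 : ℕ) : ℝ) = Real.pi / 2 + k * Real.pi := by
      push_cast; ring
    simp only [Function.comp]
    rw [this, Real.sin_add_nat_mul_pi, Real.sin_pi_div_two]
    push_cast; ring
  rw [hterm, catalanConstant]
  refine Summable.hasSum (Summable.of_norm ?_)
  have h2 := ((Real.summable_one_div_nat_pow (p := 2)).2 (by norm_num)).comp_injective hinj
  refine h2.congr fun k => ?_
  simp

open HurwitzZeta in
lemma sinZeta_one_quarter_two : sinZeta ((1 / 4 : ℝ) : UnitAddCircle) 2 = catalanConstant := by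
  have h := hasSum_nat_sinZeta (1 / 4) (s := 2) (by norm_num)
  refine h.unique ?_
  convert! Complex.hasSum_ofReal.2 hasSum_sin_div_sq using 2 with n
  rw [Complex.ofReal_div]
  norm_cast

-- In the functional equation relating `1 - s` to `s`, the factor `sin (π s / 2)` vanishes at `s =
-- 2`. Only its derivative survives there, multiplied by the value of `sinZeta` at `2`, which is
-- Catalan's constant.
open HurwitzZeta in
lemma deriv_hurwitzZetaOdd_one_quarter :
    deriv (hurwitzZetaOdd ((1 / 4 : ℝ) : UnitAddCircle)) (-1) =
      ((catalanConstant / (4 * Real.pi) : ℝ) : ℂ) := by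
  set a : UnitAddCircle := ((1 / 4 : ℝ) : UnitAddCircle) with ha
  have hpi : (Real.pi : ℂ) ≠ 0 := by exact_mod_cast Real.pi_ne_zero
  have hev : (fun s => hurwitzZetaOdd a (1 - s)) =ᶠ[𝓝 2] fun s =>
      2 * (2 * Real.pi) ^ (-s) * Complex.Gamma s * Complex.sin (Real.pi * s / 2) * sinZeta a s := by
    filter_upwards [(isOpen_lt continuous_const Complex.continuous_re).mem_nhds
      (show (0 : ℝ) < (2 : ℂ).re by norm_num)] with s hs
    refine hurwitzZetaOdd_one_sub a fun n hn => ?_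
    rw [hn] at hs
    have : (0 : ℝ) < -n := by simpa using hs
    linarith [Nat.cast_nonneg (α := ℝ) n]
  have h1 : HasDerivAt (fun s => hurwitzZetaOdd a (1 - s)) (-deriv (hurwitzZetaOdd a) (-1)) 2 := by
    have hd : HasDerivAt (hurwitzZetaOdd a) (deriv (hurwitzZetaOdd a) (-1)) (1 - 2) := by
      rw [show (1 : ℂ) - 2 = -1 by norm_num]
      exact (differentiable_hurwitzZetaOdd a _).hasDerivAt
    exact (hd.comp_const_sub 1 2)
  have hA : DifferentiableAt ℂ (fun s : ℂ => 2 * (2 * (Real.pi : ℂ)) ^ (-s) * Complex.Gamma s) 2 := by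
    refine DifferentiableAt.mul (DifferentiableAt.const_mul (DifferentiableAt.const_cpow
      (by fun_prop) (Or.inl (by simp [hpi]))) 2) (Complex.differentiableAt_Gamma _ fun m hm => ?_)
    have := congrArg Complex.re hm
    simp at this
    linarith [Nat.cast_nonneg (α := ℝ) m]
  have hsin : HasDerivAt (fun s : ℂ => Complex.sin (Real.pi * s / 2))
      (Complex.cos (Real.pi * 2 / 2) * (Real.pi * 1 / 2)) 2 :=
    (((hasDerivAt_id (2 : ℂ)).const_mul (Real.pi : ℂ)).div_const 2).csin
  have hB : DifferentiableAt ℂ (sinZeta a) 2 := differentiableAt_sinZeta a 2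
  have h2 := ((hA.hasDerivAt.mul hsin).mul hB.hasDerivAt)
  have h3 := h1.unique (h2.congr_of_eventuallyEq hev)
  have e0 : (Real.pi : ℂ) * 2 / 2 = Real.pi := by ring
  have hG2 : Complex.Gamma 2 = 1 := by
    simp
  have hpow : (2 * (Real.pi : ℂ)) ^ (-2 : ℂ) = ((2 * (Real.pi : ℂ)) ^ 2)⁻¹ := by
    rw [Complex.cpow_neg]; norm_cast
  have h4 := neg_eq_iff_eq_neg.1 h3
  rw [h4]
  simp only [e0, Complex.sin_pi, Complex.cos_pi, Pi.mul_apply, hG2, hpow, ha,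
    sinZeta_one_quarter_two]
  push_cast
  field_simp
  ring_nf

-- On the circle `3/4 = -1/4`, and the odd Hurwitz zeta function is half the difference of the
-- values at `a` and `-a`.
open HurwitzZeta in
lemma deriv_hurwitzZeta_one_quarter_sub :
    (deriv (hurwitzZeta ((1 / 4 : ℝ) : UnitAddCircle)) (-1)).re
      - (deriv (hurwitzZeta ((3 / 4 : ℝ) : UnitAddCircle)) (-1)).re =
      catalanConstant / (2 * Real.pi) := by
  have hneg : ((3 / 4 : ℝ) : UnitAddCircle) = -((1 / 4 : ℝ) : UnitAddCircle) := by
    rw [eq_neg_iff_add_eq_zero, ← AddCircle.coe_add]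
    norm_num
  rw [hneg]
  set a : UnitAddCircle := ((1 / 4 : ℝ) : UnitAddCircle) with ha
  have hd : ∀ b : UnitAddCircle, DifferentiableAt ℂ (hurwitzZeta b) (-1) := fun b =>
    differentiableAt_hurwitzZeta b (by norm_num)
  have hfun : hurwitzZetaOdd a = fun s => (hurwitzZeta a s - hurwitzZeta (-a) s) / 2 :=
    funext (hurwitzZetaOdd_eq a)
  have h := (((hd a).hasDerivAt.sub (hd (-a)).hasDerivAt).div_const 2).deriv
  have h2 := deriv_hurwitzZetaOdd_one_quarter
  rw [← ha, hfun] at h2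
  have h3 := congrArg Complex.re (h.symm.trans h2)
  rw [Complex.ofReal_re] at h3
  have h4 : ((deriv (hurwitzZeta a) (-1) - deriv (hurwitzZeta (-a)) (-1)) / 2).re =
    ((deriv (hurwitzZeta a) (-1)).re - (deriv (hurwitzZeta (-a)) (-1)).re) / 2 := by
    simp
  rw [h4] at h3
  have := Real.pi_ne_zero
  field_simp at h3 ⊢
  linarith

/-! ### Pairing the factors of the alternating product -/

lemma prod_Icc_zpow_alternating {K : Type*} [Field K] (u : ℕ → K) (N : ℕ) :
    ∏ k ∈ Finset.Icc 1 (2 * N), u k ^ (-(k : ℤ) * (-1) ^ k) =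
      ∏ j ∈ Finset.range N, (u (2 * j + 1) ^ (2 * j + 1) / u (2 * j + 2) ^ (2 * j + 2)) := by
  induction N with
  | zero => simp
  | succ N ih =>
    rw [show 2 * (N + 1) = 2 * N + 1 + 1 by ring, Finset.prod_Icc_succ_top (by omega),
      Finset.prod_Icc_succ_top (by omega), ih, Finset.prod_range_succ]
    have h1 : (-((2 * N + 1 : ℕ) : ℤ) * (-1) ^ (2 * N + 1)) = ((2 * N + 1 : ℕ) : ℤ) := by
      rw [Odd.neg_one_pow ⟨N, rfl⟩]; ring
    have h2 : (-((2 * N + 1 + 1 : ℕ) : ℤ) * (-1) ^ (2 * N + 1 + 1)) = -((2 * N + 2 : ℕ) : ℤ) := by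
      rw [Even.neg_one_pow ⟨N + 1, by ring⟩]; ring
    rw [h1, h2, zpow_neg, zpow_natCast, zpow_natCast]
    ring

lemma prod_Icc_zpow_alternating_eq_exp {u : ℕ → ℝ} (hu : ∀ k, 1 ≤ k → 0 < u k) (N : ℕ) :
    ∏ k ∈ Finset.Icc 1 (2 * N), u k ^ (-(k : ℤ) * (-1) ^ k) =
      Real.exp (∑ j ∈ Finset.range N, ((2 * j + 1) * Real.log (u (2 * j + 1))
        - (2 * j + 2) * Real.log (u (2 * j + 2)))) := by
  rw [prod_Icc_zpow_alternating, Real.exp_sum]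
  refine Finset.prod_congr rfl fun j _ => ?_
  have h1 := hu (2 * j + 1) (by omega)
  have h2 := hu (2 * j + 2) (by omega)
  rw [Real.exp_sub]
  congr 1
  · rw [← Real.exp_log (pow_pos h1 (2 * j + 1)), Real.log_pow]
    push_cast; rfl
  · rw [← Real.exp_log (pow_pos h2 (2 * j + 2)), Real.log_pow]
    push_cast; rfl

lemma logHyperfactorial_succ (a : ℝ) (N : ℕ) : logHyperfactorial a (N + 1) =
    logHyperfactorial a N + ((N : ℝ) + a) * Real.log (N + a) := by
  rw [logHyperfactorial, Finset.sum_range_succ, logHyperfactorial]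

lemma logHyperfactorial_one_two_mul_succ (N : ℕ) : logHyperfactorial 1 (2 * (N + 1)) =
    logHyperfactorial 1 (2 * N) + (2 * N + 1) * Real.log (2 * N + 1)
      + (2 * N + 2) * (Real.log 2 + Real.log (N + 1)) := by
  rw [show 2 * (N + 1) = 2 * N + 1 + 1 by ring, logHyperfactorial_succ, logHyperfactorial_succ]
  rw [← Real.log_mul (by norm_num) (by positivity)]
  push_cast
  rw [show (2 * (N : ℝ) + 1 + 1) = 2 * (N + 1) by ring]
  ring

lemma log_add_half (N : ℕ) : Real.log ((N : ℝ) + 1 / 2) = Real.log (2 * N + 1) - Real.log 2 := by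
  rw [← Real.log_div (by positivity) (by norm_num)]
  congr 1; ring

lemma log_two_mul_add_two (N : ℕ) : Real.log (2 * (N : ℝ) + 2) = Real.log 2 + Real.log (N + 1) := by
  rw [← Real.log_mul (by norm_num) (by positivity)]
  congr 1; ring

lemma log_two_mul_natCast {N : ℕ} (hN : 0 < N) :
    Real.log ((2 * N : ℕ) : ℝ) = Real.log 2 + Real.log N := by
  have : (N : ℝ) ≠ 0 := by exact_mod_cast hN.ne'
  push_cast
  rw [Real.log_mul (by norm_num) this]

lemma tendsto_wallis_log :
    Tendsto (fun N : ℕ => ∑ i ∈ Finset.range N, (Real.log (i + 1 / 2) - Real.log (i + 1))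
      + 1 / 2 * Real.log N) atTop (𝓝 (-(1 / 2 * Real.log Real.pi))) := by
  have h := tendsto_sum_log_sub_log (a := 1 / 2) (b := 1) (by norm_num) (by norm_num)
  rw [Real.Gamma_one, Real.log_one, Real.Gamma_one_half_eq, Real.log_sqrt Real.pi_pos.le] at h
  convert h using 2
  · ring
  · ring

lemma tendsto_two_mul_atTop : Tendsto (fun N : ℕ => 2 * N) atTop atTop :=
  tendsto_id.const_mul_atTop' (by norm_num)

/-! ### The case `x = 1/2` -/

/-- Collecting equal logarithms gives `log m` the weight `2m - 1` for even `m` and `-(2m - 1)` for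
odd `m`, up to the boundary term. The even-minus-odd sum of `m log m` is twice the even part minus
the whole, and the even part reduces to `logHyperfactorial 1 N`. -/
lemma sum_alternating_log_succ (N : ℕ) :
    ∑ j ∈ Finset.range N, ((2 * (j : ℝ) + 1) * (Real.log (2 * j + 2) - Real.log (2 * j + 1))
        - (2 * j + 2) * (Real.log (2 * j + 3) - Real.log (2 * j + 2))) =
      -2 * logHyperfactorial 1 (2 * N) + 8 * logHyperfactorial 1 N
        + 4 * Real.log 2 * N * (N + 1)
        + ∑ i ∈ Finset.range N, (Real.log (i + 1 / 2) - Real.log (i + 1))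
        - 2 * N * Real.log (2 * N + 1) := by
  induction N with
  | zero => simp [logHyperfactorial]
  | succ N ih =>
    rw [Finset.sum_range_succ, ih, Finset.sum_range_succ, logHyperfactorial_one_two_mul_succ,
      logHyperfactorial_succ, log_add_half, log_two_mul_add_two]
    push_cast
    rw [show (2 * ((N : ℝ) + 1) + 1) = 2 * N + 3 by ring]
    ring

lemma tendsto_prod_one_add_inv :
    Tendsto (fun N : ℕ => ∏ k ∈ Finset.Icc 1 (2 * N),
        (1 + 1 / (k : ℝ)) ^ (-(k : ℤ) * (-1) ^ k)) atTop
      (𝓝 (glaisher ^ 6 / (Real.exp 1 * √Real.pi * (2 : ℝ) ^ (1 / 6 : ℝ)))) := by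
  have hval : glaisher ^ 6 / (Real.exp 1 * √Real.pi * (2 : ℝ) ^ (1 / 6 : ℝ)) =
      Real.exp (-2 * Real.log glaisher + 8 * Real.log glaisher + -(1 / 2 * Real.log Real.pi)
        - 1 - 1 / 6 * Real.log 2) := by
    have hg := glaisher_pos
    have hp := Real.pi_pos
    rw [← Real.log_injOn_pos.eq_iff (by simp; positivity) (Real.exp_pos _), Real.log_exp,
      Real.log_div (by positivity) (by positivity), Real.log_mul (by positivity) (by positivity),
      Real.log_mul (by positivity) (by positivity), Real.log_pow, Real.log_exp,
      Real.log_sqrt hp.le, Real.log_rpow (by norm_num)]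
    push_cast; ring
  rw [hval]
  have hprod : ∀ N : ℕ, ∏ k ∈ Finset.Icc 1 (2 * N), (1 + 1 / (k : ℝ)) ^ (-(k : ℤ) * (-1) ^ k) =
      Real.exp (-2 * logHyperfactorial 1 (2 * N) + 8 * logHyperfactorial 1 N
        + 4 * Real.log 2 * N * (N + 1)
        + ∑ i ∈ Finset.range N, (Real.log (i + 1 / 2) - Real.log (i + 1))
        - 2 * N * Real.log (2 * N + 1)) := by
    intro N
    rw [prod_Icc_zpow_alternating_eq_exp (u := fun k => 1 + 1 / (k : ℝ))
      (fun k hk => by positivity), ← sum_alternating_log_succ]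
    congr 1
    refine Finset.sum_congr rfl fun j _ => ?_
    rw [← Real.log_div (by positivity) (by positivity),
      ← Real.log_div (by positivity) (by positivity)]
    push_cast
    congr 3
    · field_simp; ring
    · field_simp; ring
  simp only [hprod]
  refine (Real.continuous_exp.tendsto _).comp ?_
  have h := ((((tendsto_logHyperfactorial_one.comp tendsto_two_mul_atTop).const_mul (-2)).add
    (tendsto_logHyperfactorial_one.const_mul 8)).add tendsto_wallis_log).sub
    ((tendsto_mul_log_add_sub_log 1).comp tendsto_two_mul_atTop)
  -- The term `(1/12) log (2N)` in the expansion at `2N`, with weight `-2`, leaves `-(1/6) log 2`;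
  -- all other multiples of `log 2` cancel.
  refine (h.sub_const (1 / 6 * Real.log 2)).congr' ?_
  filter_upwards [eventually_gt_atTop 0] with N hN
  simp only [Function.comp, log_two_mul_natCast hN]
  push_cast
  ring

/-! ### The case `x = 2` -/

/-- The shift by `4` preserves parity, so away from the boundary the weights of a given logarithm
differ by the constant `4`. No sum of type `m log m` remains. -/
lemma sum_alternating_log_add_four (N : ℕ) :
    ∑ j ∈ Finset.range N, ((2 * (j : ℝ) + 1) * (Real.log (2 * j + 5) - Real.log (2 * j + 1))
        - (2 * j + 2) * (Real.log (2 * j + 6) - Real.log (2 * j + 2))) =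
      -4 * ∑ i ∈ Finset.range N, (Real.log (i + 1 / 2) - Real.log (i + 1))
        + (Real.log 3 - 2 * Real.log 2)
        + (2 * N - 3) * Real.log (2 * N + 1) - (2 * N - 2) * Real.log (2 * N + 2)
        + (2 * N - 1) * Real.log (2 * N + 3) - 2 * N * Real.log (2 * N + 4) := by
  induction N with
  | zero => simp
  | succ N ih =>
    have e : Real.log ((N : ℝ) + 1) = Real.log (2 * N + 2) - Real.log 2 := by
      rw [log_two_mul_add_two]; ring
    rw [Finset.sum_range_succ, ih, Finset.sum_range_succ, log_add_half, e]
    push_cast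
    rw [show (2 * ((N : ℝ) + 1) + 1) = 2 * N + 3 by ring,
      show (2 * ((N : ℝ) + 1) + 2) = 2 * N + 4 by ring,
      show (2 * ((N : ℝ) + 1) + 3) = 2 * N + 5 by ring,
      show (2 * ((N : ℝ) + 1) + 4) = 2 * N + 6 by ring]
    ring

lemma tendsto_prod_one_add_four_div :
    Tendsto (fun N : ℕ => ∏ k ∈ Finset.Icc 1 (2 * N),
        (1 + 4 / (k : ℝ)) ^ (-(k : ℤ) * (-1) ^ k)) atTop
      (𝓝 (3 * Real.pi ^ 2 / (16 * Real.exp 1 ^ 2))) := by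
  -- The boundary weights add up to `-2`, so replacing each boundary logarithm by `log (2N)` yields
  -- the separate `-2 log 2`. The last bracket collects the limits of the resulting errors.
  have hval : 3 * Real.pi ^ 2 / (16 * Real.exp 1 ^ 2) =
      Real.exp (-4 * -(1 / 2 * Real.log Real.pi) + (Real.log 3 - 2 * Real.log 2)
        - 2 * Real.log 2 + ((1 - 3 * 0) - (2 - 2 * 0) + (3 - 0) - 4)) := by
    have hp := Real.pi_pos
    rw [← Real.log_injOn_pos.eq_iff (by simp; positivity) (Real.exp_pos _), Real.log_exp,
      Real.log_div (by positivity) (by positivity), Real.log_mul (by positivity) (by positivity),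
      Real.log_mul (by positivity) (by positivity), Real.log_pow, Real.log_pow, Real.log_exp,
      show (16 : ℝ) = 2 ^ 4 by norm_num, Real.log_pow]
    push_cast; ring
  rw [hval]
  have hprod : ∀ N : ℕ, ∏ k ∈ Finset.Icc 1 (2 * N), (1 + 4 / (k : ℝ)) ^ (-(k : ℤ) * (-1) ^ k) =
      Real.exp (-4 * ∑ i ∈ Finset.range N, (Real.log (i + 1 / 2) - Real.log (i + 1))
        + (Real.log 3 - 2 * Real.log 2)
        + (2 * N - 3) * Real.log (2 * N + 1) - (2 * N - 2) * Real.log (2 * N + 2)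
        + (2 * N - 1) * Real.log (2 * N + 3) - 2 * N * Real.log (2 * N + 4)) := by
    intro N
    rw [prod_Icc_zpow_alternating_eq_exp (u := fun k => 1 + 4 / (k : ℝ))
      (fun k hk => by positivity), ← sum_alternating_log_add_four]
    congr 1
    refine Finset.sum_congr rfl fun j _ => ?_
    rw [← Real.log_div (by positivity) (by positivity),
      ← Real.log_div (by positivity) (by positivity)]
    push_cast
    congr 3
    · field_simp; ring
    · field_simp; ring
  simp only [hprod]
  refine (Real.continuous_exp.tendsto _).comp ?_
  have t := fun i : ℝ => (tendsto_log_add_sub_log i).comp tendsto_two_mul_atTop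
  have m := fun i : ℝ => (tendsto_mul_log_add_sub_log i).comp tendsto_two_mul_atTop
  have h := (((tendsto_wallis_log.const_mul (-4)).add_const (Real.log 3 - 2 * Real.log 2)).sub_const
    (2 * Real.log 2)).add (((((m 1).sub ((t 1).const_mul 3)).sub
      ((m 2).sub ((t 2).const_mul 2))).add ((m 3).sub (t 3))).sub (m 4))
  refine h.congr' ?_
  filter_upwards [eventually_gt_atTop 0] with N hN
  simp only [Function.comp, log_two_mul_natCast hN]
  push_cast
  ring

/-! ### The case `x = -1/4` -/

lemma log_four_mul_add_one (N : ℕ) :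
    Real.log (4 * (N : ℝ) + 1) = 2 * Real.log 2 + Real.log (N + 1 / 4) := by
  rw [show (4 * (N : ℝ) + 1) = 2 ^ 2 * (N + 1 / 4) by ring,
    Real.log_mul (by norm_num) (by positivity), Real.log_pow]
  norm_num

lemma log_four_mul_add_three (N : ℕ) :
    Real.log (4 * (N : ℝ) + 3) = 2 * Real.log 2 + Real.log (N + 3 / 4) := by
  rw [show (4 * (N : ℝ) + 3) = 2 ^ 2 * (N + 3 / 4) by ring,
    Real.log_mul (by norm_num) (by positivity), Real.log_pow]
  norm_num

/-- The numerators are rescaled by `2j + 1 = 2(j + 1/4) + 1/2` and `2j + 2 = 2(j + 3/4) + 1/2`,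
giving hyperfactorials and half a Gamma quotient at `1/4` and `3/4`. The denominators `2k` give the
alternating sum of `k log k`. -/
lemma sum_alternating_log_sub_half (N : ℕ) :
    ∑ j ∈ Finset.range N, ((2 * (j : ℝ) + 1) * (Real.log (4 * j + 1) - Real.log (4 * j + 2))
        - (2 * j + 2) * (Real.log (4 * j + 3) - Real.log (4 * j + 4))) =
      2 * (logHyperfactorial (1 / 4) N - logHyperfactorial (3 / 4) N) - 2 * N * Real.log 2
        + 1 / 2 * ∑ i ∈ Finset.range N, (Real.log (i + 1 / 4) - Real.log (i + 3 / 4))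
        - (logHyperfactorial 1 (2 * N) - 4 * logHyperfactorial 1 N
          - 2 * Real.log 2 * N * (N + 1)) + N * Real.log 2 := by
  induction N with
  | zero => simp [logHyperfactorial]
  | succ N ih =>
    have e2 : Real.log (4 * (N : ℝ) + 2) = Real.log 2 + Real.log (2 * N + 1) := by
      rw [← Real.log_mul (by norm_num) (by positivity)]; congr 1; ring
    have e4 : Real.log (4 * (N : ℝ) + 4) = 2 * Real.log 2 + Real.log (N + 1) := by
      rw [show (4 * (N : ℝ) + 4) = 2 ^ 2 * (N + 1) by ring,
        Real.log_mul (by norm_num) (by positivity), Real.log_pow]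
      norm_num
    rw [Finset.sum_range_succ, ih, Finset.sum_range_succ, logHyperfactorial_one_two_mul_succ,
      logHyperfactorial_succ, logHyperfactorial_succ, logHyperfactorial_succ,
      log_four_mul_add_one, log_four_mul_add_three, e2, e4]
    push_cast
    ring

lemma log_Gamma_three_quarters :
    Real.log (Real.Gamma (3 / 4)) =
      Real.log Real.pi + 1 / 2 * Real.log 2 - Real.log (Real.Gamma (1 / 4)) := by
  have h := Real.Gamma_mul_Gamma_one_sub (1 / 4)
  have h1 : 0 < Real.Gamma (1 / 4) := Real.Gamma_pos_of_pos (by norm_num)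
  have h2 : 0 < Real.Gamma (3 / 4) := Real.Gamma_pos_of_pos (by norm_num)
  rw [show Real.pi * (1 / 4) = Real.pi / 4 by ring, Real.sin_pi_div_four,
    show (1 : ℝ) - 1 / 4 = 3 / 4 by norm_num] at h
  have h3 := congrArg Real.log h
  rw [Real.log_mul h1.ne' h2.ne', Real.log_div Real.pi_ne_zero (by positivity),
    Real.log_div (by positivity) (by norm_num), Real.log_sqrt (by norm_num)] at h3
  linarith

lemma tendsto_prod_one_sub_half_div :
    Tendsto (fun N : ℕ => ∏ k ∈ Finset.Icc 1 (2 * N),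
        (1 - 1 / (2 * (k : ℝ))) ^ (-(k : ℤ) * (-1) ^ k)) atTop
      (𝓝 (glaisher ^ 3 * Real.exp (-catalanConstant / Real.pi) * √Real.pi *
        (2 : ℝ) ^ (1 / 6 : ℝ) / Real.Gamma (1 / 4))) := by
  have hG : 0 < Real.Gamma (1 / 4) := Real.Gamma_pos_of_pos (by norm_num)
  have hp := Real.pi_pos
  set z1 := (deriv (HurwitzZeta.hurwitzZeta ((1 / 4 : ℝ) : UnitAddCircle)) (-1)).re with hz1
  set z3 := (deriv (HurwitzZeta.hurwitzZeta ((3 / 4 : ℝ) : UnitAddCircle)) (-1)).re with hz3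
  have hz : z1 - z3 = catalanConstant / (2 * Real.pi) := deriv_hurwitzZeta_one_quarter_sub
  have hval : glaisher ^ 3 * Real.exp (-catalanConstant / Real.pi) * √Real.pi *
        (2 : ℝ) ^ (1 / 6 : ℝ) / Real.Gamma (1 / 4) =
      Real.exp (2 * ((1 / 12 + ((1 / 4) ^ 2 - 1 / 4) / 2 - z1)
          - (1 / 12 + ((3 / 4) ^ 2 - 3 / 4) / 2 - z3))
        + 1 / 2 * (Real.log (Real.Gamma (3 / 4)) - Real.log (Real.Gamma (1 / 4)))
        - Real.log glaisher + 4 * Real.log glaisher - 1 / 12 * Real.log 2) := by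
    have hg := glaisher_pos
    rw [← Real.log_injOn_pos.eq_iff (by simp; positivity) (Real.exp_pos _), Real.log_exp,
      Real.log_div (by positivity) (by positivity), Real.log_mul (by positivity) (by positivity),
      Real.log_mul (by positivity) (by positivity), Real.log_mul (by positivity) (by positivity),
      Real.log_pow, Real.log_exp, Real.log_sqrt hp.le, Real.log_rpow (by norm_num),
      log_Gamma_three_quarters]
    have hz' : -catalanConstant / Real.pi = -2 * (z1 - z3) := by rw [hz]; field_simp
    rw [hz']
    push_cast; ring
  rw [hval]
  have hprod : ∀ N : ℕ,
      ∏ k ∈ Finset.Icc 1 (2 * N), (1 - 1 / (2 * (k : ℝ))) ^ (-(k : ℤ) * (-1) ^ k) =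
      Real.exp (2 * (logHyperfactorial (1 / 4) N - logHyperfactorial (3 / 4) N)
        - 2 * N * Real.log 2
        + 1 / 2 * ∑ i ∈ Finset.range N, (Real.log (i + 1 / 4) - Real.log (i + 3 / 4))
        - (logHyperfactorial 1 (2 * N) - 4 * logHyperfactorial 1 N
          - 2 * Real.log 2 * N * (N + 1)) + N * Real.log 2) := by
    intro N
    rw [prod_Icc_zpow_alternating_eq_exp (u := fun k => 1 - 1 / (2 * (k : ℝ)))
      (fun k hk => ?_), ← sum_alternating_log_sub_half]
    · congr 1
      refine Finset.sum_congr rfl fun j _ => ?_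
      rw [← Real.log_div (by positivity) (by positivity),
        ← Real.log_div (by positivity) (by positivity)]
      push_cast
      congr 3
      · field_simp; ring
      · field_simp; ring
    · have hk' : (1 : ℝ) ≤ k := by exact_mod_cast hk
      rw [sub_pos, div_lt_one (by positivity)]
      linarith
  simp only [hprod]
  refine (Real.continuous_exp.tendsto _).comp ?_
  -- The quadratic coefficient `a^2/2 - a/2 + 1/12` agrees at `1/4` and `3/4`, so those parts
  -- cancel. The final `(1/12) log 2` comes from the expansion at `2N`.
  have h := ((((((tendsto_logHyperfactorial (a := 1 / 4) (by norm_num) (by norm_num)).sub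
    (tendsto_logHyperfactorial (a := 3 / 4) (by norm_num) (by norm_num))).const_mul 2).add
    ((tendsto_sum_log_sub_log (a := 1 / 4) (b := 3 / 4) (by norm_num) (by norm_num)).const_mul
      (1 / 2))).sub
    (tendsto_logHyperfactorial_one.comp tendsto_two_mul_atTop)).add
    (tendsto_logHyperfactorial_one.const_mul 4)).sub_const (1 / 12 * Real.log 2)
  refine h.congr' ?_
  filter_upwards [eventually_gt_atTop 0] with N hN
  simp only [Function.comp, log_two_mul_natCast hN]
  push_cast
  ring

/-! ### The Barnes product and the general limit -/

/-- The factors of the canonical product of the Barnes `G`-function. -/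
noncomputable def barnesFactor (z : ℂ) (k : ℕ) : ℂ :=
  (1 + z / ((k : ℂ) + 1)) ^ (k + 1) * Complex.exp (z ^ 2 / (2 * ((k : ℂ) + 1)) - z)

noncomputable def barnesLogFactor (z : ℂ) (k : ℕ) : ℂ :=
  ((k : ℂ) + 1) * Complex.log (1 + z / ((k : ℂ) + 1)) + (z ^ 2 / (2 * ((k : ℂ) + 1)) - z)

lemma barnesG_add_one (z : ℂ) : barnesG (z + 1) =
    Complex.exp (z / 2 * (Real.log (2 * Real.pi) : ℝ)
      - (z + z ^ 2 * (1 + (Real.eulerMascheroniConstant : ℂ))) / 2) * ∏' k, barnesFactor z k := by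
  simp only [barnesG, barnesFactor, add_sub_cancel_right]

lemma one_add_div_ne_zero_of_neg_one_lt_re {z : ℂ} (hz : -1 < z.re) (k : ℕ) :
    1 + z / ((k : ℂ) + 1) ≠ 0 := by
  intro h
  have hk : ((k : ℂ) + 1) ≠ 0 := Nat.cast_add_one_ne_zero k
  have h1 : (k : ℂ) + 1 + z = 0 := by field_simp at h; simpa using h
  have h2 := congrArg Complex.re h1
  simp at h2
  linarith [Nat.cast_nonneg (α := ℝ) k]

lemma barnesFactor_eq_exp {z : ℂ} (hz : -1 < z.re) (k : ℕ) :
    barnesFactor z k = Complex.exp (barnesLogFactor z k) := by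
  rw [barnesFactor, barnesLogFactor, Complex.exp_add]
  congr 1
  have : ((k : ℂ) + 1) = ((k + 1 : ℕ) : ℂ) := by push_cast; rfl
  conv_rhs => rw [this, Complex.exp_nat_mul, ← this,
    Complex.exp_log (one_add_div_ne_zero_of_neg_one_lt_re hz k)]

/-- The added terms cancel the logarithm's Taylor polynomial of degree two. What remains is `k + 1`
times a cubic error in `z/(k+1)`, hence `O(1/(k+1)^2)`. -/
lemma summable_barnesLogFactor (z : ℂ) : Summable (barnesLogFactor z) := by
  have hs : Summable fun k : ℕ => ‖z‖ ^ 3 * (1 / (((k + 1 : ℕ) : ℝ) ^ 2)) :=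
    ((summable_nat_add_iff 1).2 ((Real.summable_one_div_nat_pow (p := 2)).2 (by norm_num))).mul_left _
  refine Summable.of_norm_bounded_eventually_nat hs ?_
  filter_upwards [(tendsto_natCast_add_atTop 1).eventually_ge_atTop (2 * ‖z‖)] with k hk
  have hk0 : (0 : ℝ) < (k : ℝ) + 1 := by positivity
  have hkc : ((k : ℂ) + 1) ≠ 0 := Nat.cast_add_one_ne_zero k
  have hnk : ‖(k : ℂ) + 1‖ = (k : ℝ) + 1 := by
    have : ((k : ℂ) + 1) = (((k : ℝ) + 1 : ℝ) : ℂ) := by push_cast; rfl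
    rw [this, Complex.norm_real, Real.norm_of_nonneg hk0.le]
  set w := z / ((k : ℂ) + 1) with hw
  have hwn : ‖w‖ = ‖z‖ / (k + 1) := by rw [hw, norm_div, hnk]
  have hw2 : ‖w‖ ≤ 1 / 2 := by rw [hwn, div_le_iff₀ hk0]; linarith
  have h := Complex.norm_log_sub_logTaylor_le 2 (z := w) (by linarith)
  have he : barnesLogFactor z k =
      ((k : ℂ) + 1) * (Complex.log (1 + w) - Complex.logTaylor (2 + 1) w) := by
    have hT : Complex.logTaylor (2 + 1) w = w - w ^ 2 / 2 := by
      simp [Complex.logTaylor, Finset.sum_range_succ]; ring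
    rw [hT, barnesLogFactor, ← hw]
    rw [hw]
    field_simp
    ring
  rw [he, norm_mul, hnk]
  have hinv : (1 - ‖w‖)⁻¹ ≤ 2 := by
    rw [inv_le_comm₀ (by linarith) (by norm_num)]; linarith
  calc _ ≤ ((k : ℝ) + 1) * (‖w‖ ^ (2 + 1) * (1 - ‖w‖)⁻¹ / ((2 : ℕ) + 1)) := by gcongr
    _ ≤ ((k : ℝ) + 1) * (‖w‖ ^ (2 + 1) * 2 / ((2 : ℕ) + 1)) := by gcongr
    _ = (2 / 3) * (‖z‖ ^ 3 * (1 / (((k + 1 : ℕ) : ℝ) ^ 2))) := by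
      rw [hwn]; push_cast; field_simp; norm_num
    _ ≤ 1 * (‖z‖ ^ 3 * (1 / (((k + 1 : ℕ) : ℝ) ^ 2))) := by gcongr; norm_num
    _ = _ := one_mul _

lemma hasProd_barnesFactor {z : ℂ} (hz : -1 < z.re) :
    HasProd (barnesFactor z) (Complex.exp (∑' k, barnesLogFactor z k)) := by
  have : barnesFactor z = fun k => Complex.exp (barnesLogFactor z k) :=
    funext (barnesFactor_eq_exp hz)
  rw [this]
  exact (summable_barnesLogFactor z).hasSum.cexp

lemma tendsto_prod_barnesFactor {z : ℂ} (hz : -1 < z.re) :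
    Tendsto (fun N : ℕ => ∏ k ∈ Finset.range N, barnesFactor z k) atTop
      (𝓝 (∏' k, barnesFactor z k)) := by
  rw [(hasProd_barnesFactor hz).tprod_eq]
  exact (hasProd_barnesFactor hz).tendsto_prod_nat

lemma tprod_barnesFactor_ne_zero {z : ℂ} (hz : -1 < z.re) : ∏' k, barnesFactor z k ≠ 0 := by
  rw [(hasProd_barnesFactor hz).tprod_eq]
  exact Complex.exp_ne_zero _

/-- With `A`, `B`, `D` the bases of the three Barnes factors, the pair is `(A/B)^(2j+1) / D^(2j+2)`.
The missing power of `A/B` accounts for the quotient `B/A`. In the convergence exponentials the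
linear terms cancel and the squares leave `-x/(j+1)`, which `exp (x/(j+1))` compensates. -/
lemma alternating_factor_eq {x : ℂ} (hx : -(1 / 2 : ℝ) < x.re) (j : ℕ) :
    (1 + 2 * x / ((2 * j + 1 : ℕ) : ℂ)) ^ (2 * j + 1) /
        (1 + 2 * x / ((2 * j + 2 : ℕ) : ℂ)) ^ (2 * j + 2) =
      (barnesFactor (x - 1 / 2) j / (barnesFactor (-(1 / 2)) j * barnesFactor x j)) ^ 2 *
        Complex.exp (x * (1 / ((j : ℂ) + 1))) * ((1 / 2 + j) / (x + 1 / 2 + j)) := by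
  have hj : ((j : ℂ) + 1) ≠ 0 := Nat.cast_add_one_ne_zero j
  have hj2 : (2 * (j : ℂ) + 1) ≠ 0 := by exact_mod_cast Nat.succ_ne_zero (2 * j)
  set A := 1 + (x - 1 / 2) / ((j : ℂ) + 1) with hA
  set B := 1 + (-(1 / 2)) / ((j : ℂ) + 1) with hB
  set D := 1 + x / ((j : ℂ) + 1) with hD
  have hA0 : A ≠ 0 := one_add_div_ne_zero_of_neg_one_lt_re (by norm_num; norm_num at hx; linarith) j
  have hB0 : B ≠ 0 := one_add_div_ne_zero_of_neg_one_lt_re (by norm_num) j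
  have hD0 : D ≠ 0 := one_add_div_ne_zero_of_neg_one_lt_re (by norm_num at hx; linarith) j
  have eB : B * (j + 1) = 1 / 2 + j := by rw [hB]; field_simp; ring
  have eA : A * (j + 1) = x + 1 / 2 + j := by rw [hA]; field_simp; ring
  have e1 : 1 + 2 * x / ((2 * j + 1 : ℕ) : ℂ) = A / B := by
    rw [eq_div_iff hB0, hA, hB]; push_cast; field_simp; ring
  have e2 : 1 + 2 * x / ((2 * j + 2 : ℕ) : ℂ) = D := by
    rw [hD]; push_cast
    rw [show (2 * (j : ℂ) + 2) = 2 * (j + 1) by ring, mul_div_mul_left _ _ two_ne_zero]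
  have e3 : (1 / 2 + (j : ℂ)) / (x + 1 / 2 + j) = B / A := by
    rw [← eB, ← eA, mul_div_mul_right _ _ hj]
  rw [e1, e2, e3]
  simp only [barnesFactor, ← hA, ← hB, ← hD]
  have hexp : (Complex.exp ((x - 1 / 2) ^ 2 / (2 * ((j : ℂ) + 1)) - (x - 1 / 2)) /
      (Complex.exp ((-(1 / 2)) ^ 2 / (2 * ((j : ℂ) + 1)) - -(1 / 2)) *
        Complex.exp (x ^ 2 / (2 * ((j : ℂ) + 1)) - x))) ^ 2 *
      Complex.exp (x * (1 / ((j : ℂ) + 1))) = 1 := by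
    rw [← Complex.exp_add, ← Complex.exp_sub, ← Complex.exp_nat_mul, ← Complex.exp_add,
      ← Complex.exp_zero]
    congr 1
    push_cast
    field_simp
    ring
  set EA := Complex.exp ((x - 1 / 2) ^ 2 / (2 * ((j : ℂ) + 1)) - (x - 1 / 2))
  set EB := Complex.exp ((-(1 / 2)) ^ 2 / (2 * ((j : ℂ) + 1)) - -(1 / 2))
  set ED := Complex.exp (x ^ 2 / (2 * ((j : ℂ) + 1)) - x)
  calc (A / B) ^ (2 * j + 1) / D ^ (2 * j + 2)
      = (A ^ (j + 1) / (B ^ (j + 1) * D ^ (j + 1))) ^ 2 * (B / A) := by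
        rw [div_pow, div_pow, mul_pow, ← pow_mul, ← pow_mul, ← pow_mul]
        rw [show (j + 1) * 2 = 2 * j + 1 + 1 by ring, pow_succ A, pow_succ B]
        field_simp
        ring
    _ = (A ^ (j + 1) / (B ^ (j + 1) * D ^ (j + 1))) ^ 2 *
        ((EA / (EB * ED)) ^ 2 * Complex.exp (x * (1 / ((j : ℂ) + 1)))) * (B / A) := by
        rw [hexp, mul_one]
    _ = _ := by
        rw [mul_mul_mul_comm (B ^ (j + 1)), mul_div_mul_comm]
        ring

lemma GammaSeq_div_GammaSeq {s t : ℂ} (hs : 0 < s.re) (ht : 0 < t.re) {N : ℕ} (hN : 0 < N) :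
    -- `Complex.GammaSeq` also contains the factor `j = N`, absent on the left; the last quotient
    -- restores it.
    (N : ℂ) ^ (s - t) * ∏ j ∈ Finset.range N, ((t + j) / (s + j)) =
      Complex.GammaSeq s N / Complex.GammaSeq t N * ((s + N) / (t + N)) := by
  have hne : ∀ u : ℂ, 0 < u.re → ∀ j : ℕ, u + j ≠ 0 := by
    intro u hu j h
    have := congrArg Complex.re h
    simp at this
    linarith [Nat.cast_nonneg (α := ℝ) j]
  have hN' : (N : ℂ) ≠ 0 := by exact_mod_cast hN.ne'
  have hp : ∀ u : ℂ, 0 < u.re → ∏ j ∈ Finset.range N, (u + j) ≠ 0 := fun u hu =>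
    Finset.prod_ne_zero_iff.2 fun j _ => hne u hu j
  have hf : (N.factorial : ℂ) ≠ 0 := by exact_mod_cast N.factorial_ne_zero
  have hc : (N : ℂ) ^ t ≠ 0 := by simp [Complex.cpow_eq_zero_iff, hN']
  have h1 := hp s hs
  have h2 := hp t ht
  have h3 := hne s hs N
  have h4 := hne t ht N
  rw [Complex.GammaSeq, Complex.GammaSeq, Finset.prod_range_succ, Finset.prod_range_succ,
    Finset.prod_div_distrib, Complex.cpow_sub _ _ hN']
  field_simp

lemma tendsto_add_div_add (s t : ℂ) :
    Tendsto (fun N : ℕ => (s + N) / (t + N)) atTop (𝓝 1) := by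
  have ht : Tendsto (fun N : ℕ => ((N : ℂ))⁻¹) atTop (𝓝 0) := tendsto_inv_atTop_nhds_zero_nat
  have h := ((ht.const_mul s).add_const 1).div ((ht.const_mul t).add_const 1) (by simp)
  simp only [mul_zero, zero_add, div_one] at h
  refine h.congr' ?_
  filter_upwards [eventually_gt_atTop 0] with N hN
  have hN' : (N : ℂ) ≠ 0 := by exact_mod_cast hN.ne'
  have e : ∀ u : ℂ, u * (N : ℂ)⁻¹ + 1 = (u + N) / N := fun u => by field_simp
  simp only [Pi.div_apply, e]
  rw [div_div_div_cancel_right₀ hN']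

/-- In the prefactors of `barnesG` the `log (2π)` and linear terms cancel. The quadratic ones give
`x(1+γ)` after squaring, and `exp (-x)` removes all but `xγ`. -/
lemma exp_mul_barnesG_ratio (x : ℂ) :
    Complex.exp (-x) * (barnesG (x + 1 / 2) / (barnesG (x + 1) * barnesG (1 / 2))) ^ 2 =
      ((∏' k, barnesFactor (x - 1 / 2) k) /
        ((∏' k, barnesFactor (-(1 / 2)) k) * ∏' k, barnesFactor x k)) ^ 2 *
        Complex.exp (x * (Real.eulerMascheroniConstant : ℂ)) := by
  rw [show x + 1 / 2 = (x - 1 / 2) + 1 by ring, barnesG_add_one, barnesG_add_one,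
    show (1 / 2 : ℂ) = -(1 / 2) + 1 by norm_num, barnesG_add_one]
  rw [show x - (-(1 / 2) + 1) = x - 1 / 2 by ring, show -(-(1 / 2) + 1) = -(1 / 2 : ℂ) by ring]
  set L : ℂ := ((Real.log (2 * Real.pi) : ℝ) : ℂ)
  set g : ℂ := (Real.eulerMascheroniConstant : ℂ)
  set P1 := ∏' k, barnesFactor (x - 1 / 2) k
  set P2 := ∏' k, barnesFactor (-(1 / 2)) k
  set P3 := ∏' k, barnesFactor x k
  have hexp : Complex.exp (-x) * (Complex.exp ((x - 1 / 2) / 2 * L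
        - ((x - 1 / 2) + (x - 1 / 2) ^ 2 * (1 + g)) / 2) /
      (Complex.exp (x / 2 * L - (x + x ^ 2 * (1 + g)) / 2) *
        Complex.exp (-(1 / 2) / 2 * L - (-(1 / 2) + (-(1 / 2)) ^ 2 * (1 + g)) / 2))) ^ 2 =
      Complex.exp (x * g) := by
    rw [← Complex.exp_add, ← Complex.exp_sub, ← Complex.exp_nat_mul, ← Complex.exp_add]
    congr 1
    push_cast
    ring
  rw [← hexp, mul_mul_mul_comm, mul_div_mul_comm, mul_comm P3]
  ring

lemma tendsto_alternating_prod {x : ℂ} (hx : -(1 / 2 : ℝ) < x.re) :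
    Tendsto (fun N : ℕ => ∏ k ∈ Finset.Icc 1 (2 * N),
        (1 + 2 * x / (k : ℂ)) ^ (-(k : ℤ) * (-1) ^ k)) atTop
      (𝓝 (Complex.exp (-x) * Complex.Gamma (x + 1 / 2) / Complex.Gamma (1 / 2) *
          (barnesG (x + 1 / 2) / (barnesG (x + 1) * barnesG (1 / 2))) ^ 2)) := by
  have hre1 : -1 < (x - 1 / 2).re := by norm_num; norm_num at hx; linarith
  have hre2 : -1 < (-(1 / 2) : ℂ).re := by norm_num
  have hre3 : -1 < x.re := by norm_num at hx; linarith
  have hs : 0 < (x + 1 / 2).re := by norm_num; norm_num at hx; linarith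
  have ht : 0 < (1 / 2 : ℂ).re := by norm_num
  have hval : Complex.exp (-x) * Complex.Gamma (x + 1 / 2) / Complex.Gamma (1 / 2) *
      (barnesG (x + 1 / 2) / (barnesG (x + 1) * barnesG (1 / 2))) ^ 2 =
      ((∏' k, barnesFactor (x - 1 / 2) k) /
        ((∏' k, barnesFactor (-(1 / 2)) k) * ∏' k, barnesFactor x k)) ^ 2 *
        Complex.exp (x * (Real.eulerMascheroniConstant : ℂ)) *
        (Complex.Gamma (x + 1 / 2) / Complex.Gamma (1 / 2) * 1) := by
    rw [← exp_mul_barnesG_ratio]; ring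
  rw [hval]
  have hharm : Tendsto (fun N : ℕ => (((harmonic N : ℝ) - Real.log N : ℝ) : ℂ)) atTop
      (𝓝 (Real.eulerMascheroniConstant : ℂ)) :=
    (Complex.continuous_ofReal.tendsto _).comp Real.tendsto_harmonic_sub_log
  have h := ((((tendsto_prod_barnesFactor hre1).div ((tendsto_prod_barnesFactor hre2).mul
    (tendsto_prod_barnesFactor hre3)) (mul_ne_zero (tprod_barnesFactor_ne_zero hre2)
      (tprod_barnesFactor_ne_zero hre3))).pow 2).mul
    ((Complex.continuous_exp.tendsto _).comp (hharm.const_mul x))).mul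
    (((Complex.GammaSeq_tendsto_Gamma (x + 1 / 2)).div (Complex.GammaSeq_tendsto_Gamma (1 / 2))
      (Complex.Gamma_ne_zero_of_re_pos ht)).mul (tendsto_add_div_add (x + 1 / 2) (1 / 2)))
  refine h.congr' ?_
  filter_upwards [eventually_gt_atTop 0] with N hN
  have hN' : (N : ℂ) ≠ 0 := by exact_mod_cast hN.ne'
  rw [prod_Icc_zpow_alternating (u := fun k : ℕ => 1 + 2 * x / (k : ℂ)),
    Finset.prod_congr rfl fun j _ => alternating_factor_eq hx j]
  simp only [Pi.div_apply, Function.comp]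
  rw [← GammaSeq_div_GammaSeq hs ht hN, Finset.prod_mul_distrib, Finset.prod_mul_distrib,
    Finset.prod_pow, Finset.prod_div_distrib, Finset.prod_div_distrib,
    Finset.prod_mul_distrib, ← Complex.exp_sum,
    ← Finset.mul_sum]
  have hH : ((harmonic N : ℝ) : ℂ) = ∑ j ∈ Finset.range N, 1 / ((j : ℂ) + 1) := by
    simp [harmonic]
  -- The exponential of `x` times the harmonic number splits into a convergent part and `N ^ x`, the
  -- normalization needed by the Gamma quotient.
  have hpow : Complex.exp (x * (((harmonic N : ℝ) - Real.log N : ℝ) : ℂ)) *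
      (N : ℂ) ^ (x + 1 / 2 - 1 / 2) =
      Complex.exp (x * ∑ j ∈ Finset.range N, 1 / ((j : ℂ) + 1)) := by
    rw [add_sub_cancel_right, Complex.cpow_def_of_ne_zero hN', ← Complex.exp_add, ← hH,
      Complex.ofReal_sub, ← Complex.natCast_log]
    congr 1; ring
  rw [← hpow]
  ring

theorem proposition5 :
    (∀ x : ℂ, -(1 / 2 : ℝ) < x.re →
      Tendsto
        (fun N : ℕ => ∏ k ∈ Finset.Icc 1 (2 * N),
          (1 + 2 * x / (k : ℂ)) ^ (-(k : ℤ) * (-1) ^ k))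
        atTop
        (𝓝 (Complex.exp (-x) * Complex.Gamma (x + 1 / 2) / Complex.Gamma (1 / 2) *
          (barnesG (x + 1 / 2) / (barnesG (x + 1) * barnesG (1 / 2))) ^ 2))) ∧
    Tendsto
      (fun N : ℕ => ∏ k ∈ Finset.Icc 1 (2 * N),
        (1 + 1 / (k : ℝ)) ^ (-(k : ℤ) * (-1) ^ k))
      atTop
      (𝓝 (glaisher ^ 6 / (Real.exp 1 * √Real.pi * (2 : ℝ) ^ (1 / 6 : ℝ)))) ∧
    Tendsto
      (fun N : ℕ => ∏ k ∈ Finset.Icc 1 (2 * N),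
        (1 + 4 / (k : ℝ)) ^ (-(k : ℤ) * (-1) ^ k))
      atTop
      (𝓝 (3 * Real.pi ^ 2 / (16 * Real.exp 1 ^ 2))) ∧
    Tendsto
      (fun N : ℕ => ∏ k ∈ Finset.Icc 1 (2 * N),
        (1 - 1 / (2 * (k : ℝ))) ^ (-(k : ℤ) * (-1) ^ k))
      atTop
      (𝓝 (glaisher ^ 3 * Real.exp (-catalanConstant / Real.pi) * √Real.pi *
        (2 : ℝ) ^ (1 / 6 : ℝ) / Real.Gamma (1 / 4))) := by
  exact ⟨fun _ hx => tendsto_alternating_prod hx, tendsto_prod_one_add_inv,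
    tendsto_prod_one_add_four_div, tendsto_prod_one_sub_half_div⟩
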